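/- Let $K\ge 1$ be an integer, let $z_i, J_{ij}, \sigma_i$ ($1\le i,j\le 2K$) be real constants with $\sigma_i>0$ for all $i$, and let $\mathcal P=[0,1]^{2K}\subset\mathbb R^{2K}$. For $\mathbf p=(p_1,\dots,p_{2K})\in\mathcal P$ and $1\le i\le 2K$ put $$V_i^{+}(\mathbf p)=z_i-J_{ii}-\sum_{j\ne i}J_{ij}(2p_j-1),\qquad V_i^{-}(\mathbf p)=z_i+J_{ii}-\sum_{j\ne i}J_{ij}(2p_j-1),$$ $$f_i^{\pm}(\mathbf p)=\exp\left(-\frac{\left(V_i^{\pm}(\mathbf p)\right)^2}{2\sigma_i^2}\right),\qquad f_i(\mathbf p)=\frac{f_i^{+}(\mathbf p)}{f_i^{+}(\mathbf p)+f_i^{-}(\mathbf p)}.$$ Then the map $f=(f_1,\dots,f_{2K}):\mathcal P\to\mathcal P$ (the iteration map of the message passing detection algorithm, with the $\sigma_i$ held fixed) has a fixed point, i.e. there is $\mathbf p\in\mathcal P$ with $f(\mathbf p)=\mathbf p$. -/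

import Mathlib

open Finset

noncomputable section

namespace MPD

/-- The cube `[0,1]^{2K}` in `ℝ^{2K}`. -/
def cube (K : ℕ) : Set (Fin (2 * K) → ℝ) :=
  {p | ∀ i, p i ∈ Set.Icc (0 : ℝ) 1}

variable {K : ℕ}

/-- The interference mean `∑_{j ≠ i} J_{ij} (2 p_j - 1)`. -/
def interference (J : Matrix (Fin (2 * K)) (Fin (2 * K)) ℝ) (i : Fin (2 * K))
    (p : Fin (2 * K) → ℝ) : ℝ :=
  ∑ j ∈ univ.erase i, J i j * (2 * p j - 1)

/-- `V_i^+(p) = z_i - J_{ii} - ∑_{j ≠ i} J_{ij} (2 p_j - 1)`. -/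
def VPlus (z : Fin (2 * K) → ℝ) (J : Matrix (Fin (2 * K)) (Fin (2 * K)) ℝ) (i : Fin (2 * K))
    (p : Fin (2 * K) → ℝ) : ℝ :=
  z i - J i i - interference J i p

/-- `V_i^-(p) = z_i + J_{ii} - ∑_{j ≠ i} J_{ij} (2 p_j - 1)`. -/
def VMinus (z : Fin (2 * K) → ℝ) (J : Matrix (Fin (2 * K)) (Fin (2 * K)) ℝ) (i : Fin (2 * K))
    (p : Fin (2 * K) → ℝ) : ℝ :=
  z i + J i i - interference J i p

/-- `f_i^+(p) = exp (-(V_i^+(p))² / (2 σ_i²))`. -/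
def fPlus (z : Fin (2 * K) → ℝ) (J : Matrix (Fin (2 * K)) (Fin (2 * K)) ℝ)
    (σ : Fin (2 * K) → ℝ) (i : Fin (2 * K)) (p : Fin (2 * K) → ℝ) : ℝ :=
  Real.exp (-1 / (2 * σ i ^ 2) * VPlus z J i p ^ 2)

/-- `f_i^-(p) = exp (-(V_i^-(p))² / (2 σ_i²))`. -/
def fMinus (z : Fin (2 * K) → ℝ) (J : Matrix (Fin (2 * K)) (Fin (2 * K)) ℝ)
    (σ : Fin (2 * K) → ℝ) (i : Fin (2 * K)) (p : Fin (2 * K) → ℝ) : ℝ :=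
  Real.exp (-1 / (2 * σ i ^ 2) * VMinus z J i p ^ 2)

/-- The iteration map `f`, with components `f_i(p) = f_i^+(p) / (f_i^+(p) + f_i^-(p))`. -/
def iter (z : Fin (2 * K) → ℝ) (J : Matrix (Fin (2 * K)) (Fin (2 * K)) ℝ)
    (σ : Fin (2 * K) → ℝ) (p : Fin (2 * K) → ℝ) : Fin (2 * K) → ℝ :=
  fun i => fPlus z J σ i p / (fPlus z J σ i p + fMinus z J σ i p)

/-- The iteration map sends every vector, in particular every point of the cube, into the cube. -/
theorem iter_mem_cube (z : Fin (2 * K) → ℝ) (J : Matrix (Fin (2 * K)) (Fin (2 * K)) ℝ)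
    (σ : Fin (2 * K) → ℝ) (p : Fin (2 * K) → ℝ) : iter z J σ p ∈ cube K := by
  intro i
  have h1 : 0 < fPlus z J σ i p := Real.exp_pos _
  have h2 : 0 < fMinus z J σ i p := Real.exp_pos _
  exact ⟨(div_pos h1 (add_pos h1 h2)).le, (div_le_one (add_pos h1 h2)).2 (by linarith)⟩

/-- The iteration map as a self-map of the cube. -/
def iterOnCube (z : Fin (2 * K) → ℝ) (J : Matrix (Fin (2 * K)) (Fin (2 * K)) ℝ)
    (σ : Fin (2 * K) → ℝ) (p : cube K) : cube K :=
  ⟨iter z J σ p, iter_mem_cube z J σ p⟩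

end MPD

end

open MeasureTheory Filter Topology

/-! Each component of the iteration map is a sigmoid of an affine function, so the formula gives a
bounded, Lipschitz, `C^1` map `F` on all of `ℝ^n`; its fixed points lie in the cube because its
values do. For such `F` a fixed point comes from an analytic degree argument. Let `I_b(t) = ∫ exp(-b
|x - t F x|²) det(1 - t DF(x)) dx`. For small real `t`, `x ↦ x - t F x` is a bijection with positive
Jacobian, so `I_b(t) = (π/b)^(n/2)`. As `I_b` is entire in `t`, this persists at `t = 1`. Without a
fixed point, `|x - F x|² ≥ δ > 0`, so `I_b(1) = O(exp(-bδ))`, which contradicts the power decay as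
`b → ∞`. -/

theorem differentiable_integral_of_entire_of_dominated {α : Type*} [TopologicalSpace α]
    [MeasurableSpace α] [OpensMeasurableSpace α] {μ : Measure α} {f : α → ℂ → ℂ}
    {bound : ℝ → α → ℝ} (hc : Continuous (Function.uncurry f))
    (hd : ∀ x, Differentiable ℂ (f x)) (hi : ∀ R, Integrable (bound R) μ)
    (hb : ∀ R x t, ‖t‖ ≤ R → ‖f x t‖ ≤ bound R x) :
    Differentiable ℂ (fun t => ∫ x, f x t ∂μ) := by
  intro t
  have hm : ∀ s, AEStronglyMeasurable (fun x => f x s) μ := fun s =>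
    (hc.comp (continuous_id.prodMk continuous_const)).aestronglyMeasurable
  -- Cauchy's estimate on the unit circle about `s`, with `|s - t| < 1`, bounds the derivative;
  -- hence the radius `‖t‖ + 2`.
  refine (hasDerivAt_integral_of_dominated_loc_of_deriv_le (𝕜 := ℂ) (F := fun t x => f x t)
    (F' := fun t x => deriv (f x) t) (bound := bound (‖t‖ + 2)) (Metric.ball_mem_nhds t one_pos)
    (Eventually.of_forall hm) ?_ ?_ ?_ (hi _) ?_).2.differentiableAt
  · exact (hi ‖t‖).mono' (hm t) (Eventually.of_forall fun x => hb _ x t le_rfl)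
  · have := (measurable_deriv_with_param hc).comp (measurable_prodMk_right (y := t))
    exact this.aestronglyMeasurable
  · refine Eventually.of_forall fun x s hs => ?_
    have := Complex.norm_deriv_le_of_forall_mem_sphere_norm_le (c := s) (R := 1)
      (C := bound (‖t‖ + 2) x) one_pos (hd x).diffContOnCl fun z hz => hb _ _ _ ?_
    · simpa using this
    · have h1 : dist z t ≤ dist z s + dist s t := dist_triangle _ _ _
      have h2 : dist s t < 1 := hs
      have h3 : dist z s = 1 := hz
      have h4 : ‖z‖ ≤ ‖t‖ + ‖z - t‖ := by simpa using norm_add_le t (z - t)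
      rw [← dist_eq_norm] at h4
      linarith
  · exact Eventually.of_forall fun x s _ => (hd x s).hasDerivAt

/-! ### Gaussian integrals and the displacement `x - F x` -/

section

variable {ι : Type*} [Fintype ι]

theorem integrable_exp_neg_mul_sum_sq {b : ℝ} (hb : 0 < b) :
    Integrable (fun x : ι → ℝ => Real.exp (-b * ∑ i, x i ^ 2)) := by
  have := Integrable.fintype_prod (𝕜 := ℝ) (μ := fun _ : ι => (volume : Measure ℝ))
    (f := fun _ x => Real.exp (-b * x ^ 2)) fun _ => integrable_exp_neg_mul_sq hb
  simp only [← Real.exp_sum, ← mul_sum] at this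
  exact this

theorem integral_exp_neg_mul_sum_sq (b : ℝ) :
    ∫ x : ι → ℝ, Real.exp (-b * ∑ i, x i ^ 2) = √(Real.pi / b) ^ Fintype.card ι := by
  have := integral_fintype_prod_volume_eq_pow (ι := ι) (fun x : ℝ => Real.exp (-b * x ^ 2))
  simpa only [← Real.exp_sum, ← mul_sum, integral_gaussian] using this

theorem bijective_id_sub_of_contractingWith {E : Type*} [NormedAddCommGroup E] [CompleteSpace E]
    {g : E → E} {k : NNReal} (hk : k < 1) (hg : LipschitzWith k g) :
    Function.Bijective fun x => x - g x := by
  have hc : ∀ y : E, ContractingWith k fun x => y + g x := fun y =>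
    ⟨hk, LipschitzWith.of_dist_le_mul fun u v => by simpa using hg.dist_le_mul u v⟩
  refine ⟨fun x y hxy => ?_, fun y => ⟨ContractingWith.fixedPoint _ (hc y), ?_⟩⟩
  · have hx : Function.IsFixedPt (fun u => (x - g x) + g u) x := by simp [Function.IsFixedPt]
    have hy : Function.IsFixedPt (fun u => (x - g x) + g u) y := by
      have : x - g x = y - g y := hxy
      simp [Function.IsFixedPt, this]
    exact ((hc _).fixedPoint_unique hx).trans ((hc _).fixedPoint_unique hy).symm
  · have := (hc y).fixedPoint_isFixedPt
    rw [Function.IsFixedPt] at this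
    exact sub_eq_of_eq_add this.symm

/-- Boundedness of `F` makes `‖x - F x‖` coercive, so its infimum is attained and is positive. -/
theorem exists_le_sum_sq_sub {F : (ι → ℝ) → ι → ℝ} {C : ℝ} (hF : Continuous F)
    (hC : ∀ x, ‖F x‖ ≤ C) (hne : ∀ x, F x ≠ x) : ∃ δ > 0, ∀ x, δ ≤ ∑ i, (x i - F x i) ^ 2 := by
  have htop : Tendsto (fun x => ‖x - F x‖) (cocompact (ι → ℝ)) atTop := by
    refine tendsto_atTop_mono (fun x => ?_)
      (tendsto_atTop_add_const_right _ (-C) (tendsto_norm_cocompact_atTop (E := ι → ℝ)))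
    linarith [hC x, norm_sub_norm_le x (F x)]
  obtain ⟨x₀, hx₀⟩ := (show Continuous fun x => ‖x - F x‖ by fun_prop).exists_forall_le htop
  have hpos : 0 < ‖x₀ - F x₀‖ := norm_pos_iff.2 (sub_ne_zero.2 (hne x₀).symm)
  refine ⟨‖x₀ - F x₀‖ ^ 2, by positivity, fun x => ?_⟩
  rw [← Real.le_sqrt' hpos]
  refine (hx₀ x).trans ((pi_norm_le_iff_of_nonneg (Real.sqrt_nonneg _)).2 fun i => ?_)
  rw [Real.norm_eq_abs]
  exact Real.abs_le_sqrt (single_le_sum (f := fun i => (x i - F x i) ^ 2)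
    (fun _ _ => sq_nonneg _) (mem_univ i))

/-! ### The degree integral with complex parameter -/

variable [DecidableEq ι]

/-- The Jacobian matrix of a self-map of `ℝ^ι`. -/
noncomputable def jacobian (F : (ι → ℝ) → ι → ℝ) (x : ι → ℝ) : Matrix ι ι ℝ :=
  LinearMap.toMatrix' (fderiv ℝ F x : (ι → ℝ) →ₗ[ℝ] ι → ℝ)

/-- The density whose integral over `ℝ^ι` counts the zeros of `x ↦ x - t F(x)`, smoothed by a
Gaussian, with the parameter `t` taken to be complex. -/
noncomputable def gaussianDegreeDensity (F : (ι → ℝ) → ι → ℝ) (b : ℝ) (x : ι → ℝ) (t : ℂ) : ℂ :=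
  Complex.exp (-b * ∑ i, ((x i : ℂ) - t * F x i) ^ 2) *
    (1 - t • (jacobian F x).map Complex.ofReal).det

theorem gaussianDegreeDensity_ofReal (F : (ι → ℝ) → ι → ℝ) (b : ℝ) (x : ι → ℝ) (t : ℝ) :
    gaussianDegreeDensity F b x t =
      ((Real.exp (-b * ∑ i, (x i - t * F x i) ^ 2) * (1 - t • jacobian F x).det : ℝ) : ℂ) := by
  have h : (1 - (t : ℂ) • (jacobian F x).map Complex.ofReal) =
      (1 - t • jacobian F x).map Complex.ofRealHom := by
    ext i j
    by_cases hij : i = j <;> simp [hij]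
  rw [gaussianDegreeDensity, h, ← RingHom.mapMatrix_apply, ← RingHom.map_det]
  push_cast
  rfl

theorem det_one_sub_smul_jacobian (F : (ι → ℝ) → ι → ℝ) (x : ι → ℝ) (t : ℝ) :
    (1 - t • jacobian F x).det =
      (ContinuousLinearMap.id ℝ (ι → ℝ) - t • fderiv ℝ F x).det := by
  rw [ContinuousLinearMap.det, ← LinearMap.det_toMatrix']
  congr 1
  simp [jacobian, LinearMap.toMatrix'_id]

theorem abs_jacobian_le {F : (ι → ℝ) → ι → ℝ} {k : NNReal} (hF : LipschitzWith k F)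
    (x : ι → ℝ) (i j : ι) : |jacobian F x i j| ≤ k := by
  have h1 : ‖fderiv ℝ F x (Pi.single j 1)‖ ≤ k := by
    refine ((fderiv ℝ F x).le_opNorm _).trans ?_
    have := norm_fderiv_le_of_lipschitz ℝ (x₀ := x) hF
    simpa [Pi.norm_single] using this
  have h2 : jacobian F x i j = fderiv ℝ F x (Pi.single j 1) i := by
    simp [jacobian, LinearMap.toMatrix'_apply]
  rw [h2]
  exact (norm_le_pi_norm (fderiv ℝ F x (Pi.single j 1)) i).trans h1

theorem continuous_jacobian {F : (ι → ℝ) → ι → ℝ} (hF : ContDiff ℝ 1 F) :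
    Continuous (jacobian F) := by
  have := hF.continuous_fderiv one_ne_zero
  refine continuous_matrix fun i j => ?_
  have h2 : (fun x => jacobian F x i j) = fun x => fderiv ℝ F x (Pi.single j 1) i := by
    ext x; simp [jacobian, LinearMap.toMatrix'_apply]
  rw [h2]
  exact (continuous_apply i).comp (this.clm_apply continuous_const)

theorem continuous_gaussianDegreeDensity {F : (ι → ℝ) → ι → ℝ} (hF : ContDiff ℝ 1 F) (b : ℝ) :
    Continuous (Function.uncurry (gaussianDegreeDensity F b)) := by
  have h1 := hF.continuous
  have h2 := continuous_jacobian hF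
  have h3 : Continuous fun p : (ι → ℝ) × ℂ => (jacobian F p.1).map Complex.ofReal :=
    (h2.comp continuous_fst).matrix_map Complex.continuous_ofReal
  unfold gaussianDegreeDensity Function.uncurry
  refine Continuous.mul (by fun_prop) (Continuous.matrix_det ?_)
  exact continuous_const.sub (continuous_snd.smul h3)

theorem differentiable_gaussianDegreeDensity (F : (ι → ℝ) → ι → ℝ) (b : ℝ) (x : ι → ℝ) :
    Differentiable ℂ (gaussianDegreeDensity F b x) := by
  unfold gaussianDegreeDensity
  simp only [Matrix.det_apply, Matrix.sub_apply, Matrix.smul_apply]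
  fun_prop

/-- Complex `t` costs the Gaussian only a bounded factor because `F` is bounded; the Lipschitz
constant controls the determinant. -/
theorem norm_gaussianDegreeDensity_le {F : (ι → ℝ) → ι → ℝ} {C : ℝ} {k : NNReal} {b : ℝ}
    (hb : 0 < b) (hC : ∀ x i, |F x i| ≤ C) (hF : LipschitzWith k F) (R : ℝ) (x : ι → ℝ) (t : ℂ)
    (ht : ‖t‖ ≤ R) :
    ‖gaussianDegreeDensity F b x t‖ ≤
      Real.exp (-(b / 2) * ∑ i, x i ^ 2) * (Real.exp (b * (Fintype.card ι * (R * C) ^ 2)) *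
        ((Fintype.card ι).factorial * (1 + R * k) ^ Fintype.card ι)) := by
  have hR : 0 ≤ R := (norm_nonneg t).trans ht
  rw [gaussianDegreeDensity, norm_mul, ← mul_assoc]
  refine mul_le_mul ?_ ?_ (norm_nonneg _) (by positivity)
  · rw [Complex.norm_exp, ← Real.exp_add, Real.exp_le_exp]
    have key : ∀ i, x i ^ 2 / 2 - (R * C) ^ 2 ≤ ((((x i : ℂ) - t * F x i) ^ 2).re) := by
      intro i
      have h1 : ((((x i : ℂ) - t * F x i) ^ 2).re) =
          (x i - t.re * F x i) ^ 2 - (t.im * F x i) ^ 2 := by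
        simp [pow_two]
      have h2 : t.re ^ 2 + t.im ^ 2 = ‖t‖ ^ 2 := by
        rw [Complex.sq_norm, Complex.normSq_apply]; ring
      have h3 : (‖t‖ * |F x i|) ^ 2 ≤ (R * C) ^ 2 := by
        gcongr
        exact hC x i
      rw [mul_pow, sq_abs, ← h2] at h3
      rw [h1]
      -- The difference of the two sides, with `‖t‖² (F x i)²` in place of `(R C)²`, is half this
      -- square.
      nlinarith [sq_nonneg (x i - 2 * (t.re * F x i))]
    have h4 := sum_le_sum fun i (_ : i ∈ univ) => key i
    rw [sum_sub_distrib, ← sum_div, sum_const, nsmul_eq_mul, card_univ] at h4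
    have h5 : (-(b : ℂ) * ∑ i, ((x i : ℂ) - t * F x i) ^ 2).re =
        -b * ∑ i, (((x i : ℂ) - t * F x i) ^ 2).re := by
      rw [← Complex.ofReal_neg, Complex.re_ofReal_mul, Complex.re_sum]
    rw [h5]
    nlinarith
  · have := Matrix.det_le (A := 1 - t • (jacobian F x).map Complex.ofReal)
      (abv := NormedField.toAbsoluteValue ℂ) (x := 1 + R * k) fun i j => ?_
    · rw [nsmul_eq_mul] at this
      exact this
    · change ‖(1 - t • (jacobian F x).map Complex.ofReal) i j‖ ≤ _
      rw [Matrix.sub_apply]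
      refine (norm_sub_le _ _).trans (add_le_add ?_ ?_)
      · by_cases hij : i = j <;> simp [Matrix.one_apply, hij]
      · simp only [Matrix.smul_apply, Matrix.map_apply, smul_eq_mul, norm_mul, Complex.norm_real]
        exact mul_le_mul ht (abs_jacobian_le hF x i j) (norm_nonneg _) hR

theorem differentiable_integral_gaussianDegreeDensity {F : (ι → ℝ) → ι → ℝ} {C : ℝ} {k : NNReal}
    {b : ℝ} (hb : 0 < b) (hF : ContDiff ℝ 1 F) (hC : ∀ x i, |F x i| ≤ C) (hk : LipschitzWith k F) :
    Differentiable ℂ fun t => ∫ x, gaussianDegreeDensity F b x t :=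
  differentiable_integral_of_entire_of_dominated (continuous_gaussianDegreeDensity hF b)
    (differentiable_gaussianDegreeDensity F b)
    (fun _ => (integrable_exp_neg_mul_sum_sq (half_pos hb)).mul_const _)
    (norm_gaussianDegreeDensity_le hb hC hk)

theorem integrable_gaussianDegreeDensity {F : (ι → ℝ) → ι → ℝ} {C : ℝ} {k : NNReal}
    {b : ℝ} (hb : 0 < b) (hF : ContDiff ℝ 1 F) (hC : ∀ x i, |F x i| ≤ C) (hk : LipschitzWith k F)
    (t : ℂ) : Integrable fun x => gaussianDegreeDensity F b x t :=
  ((integrable_exp_neg_mul_sum_sq (half_pos hb)).mul_const _).mono'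
    ((continuous_gaussianDegreeDensity hF b).comp
      (continuous_id.prodMk continuous_const)).aestronglyMeasurable
    (Eventually.of_forall fun x => norm_gaussianDegreeDensity_le hb hC hk ‖t‖ x t le_rfl)

/-- Scaling `t` down to `0` keeps the matrix invertible, since a kernel vector would contradict `|t|
k < 1`; the determinant ends at `1`, so it never changes sign. -/
theorem det_one_sub_smul_jacobian_pos {F : (ι → ℝ) → ι → ℝ} {k : NNReal}
    (hk : LipschitzWith k F) {t : ℝ} (ht : |t| * k < 1) (x : ι → ℝ) :
    0 < (1 - t • jacobian F x).det := by
  have hne : ∀ s ∈ Set.Icc (0 : ℝ) 1, (1 - (s * t) • jacobian F x).det ≠ 0 := by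
    intro s hs h0
    obtain ⟨v, hv, hv0⟩ := Matrix.exists_mulVec_eq_zero_iff.2 h0
    have h1 : (jacobian F x).mulVec v = fderiv ℝ F x v := by
      simp [jacobian, LinearMap.toMatrix'_mulVec]
    rw [Matrix.sub_mulVec, Matrix.one_mulVec, Matrix.smul_mulVec, h1, sub_eq_zero] at hv0
    have h2 : ‖v‖ ≤ (|t| * k) * ‖v‖ := by
      calc ‖v‖ = ‖(s * t) • fderiv ℝ F x v‖ := by rw [← hv0]
        _ = |s| * (|t| * ‖fderiv ℝ F x v‖) := by
          rw [norm_smul, Real.norm_eq_abs, abs_mul, mul_assoc]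
        _ ≤ 1 * (|t| * (k * ‖v‖)) := by
          have := (fderiv ℝ F x).le_of_opNorm_le (norm_fderiv_le_of_lipschitz ℝ hk) v
          have hs1 : |s| ≤ 1 := abs_le.2 ⟨by linarith [hs.1], hs.2⟩
          gcongr
        _ = _ := by ring
    have h3 : 0 < ‖v‖ := norm_pos_iff.2 hv
    nlinarith
  by_contra hneg
  have hc : ContinuousOn (fun s : ℝ => (1 - (s * t) • jacobian F x).det) (Set.Icc 0 1) := by
    refine Continuous.continuousOn (Continuous.matrix_det ?_)
    fun_prop
  obtain ⟨s, hs, h0⟩ := intermediate_value_Icc' zero_le_one hc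
    (show (0 : ℝ) ∈ Set.Icc _ _ from ⟨by simpa using hneg, by simp⟩)
  exact hne s hs h0

/-- Substitute `y = x - t F x`, a bijection by the contraction principle. -/
theorem integral_gaussianDegreeDensity_of_small {F : (ι → ℝ) → ι → ℝ} {k : NNReal} (b : ℝ)
    (hF : ContDiff ℝ 1 F) (hk : LipschitzWith k F) {t : ℝ} (ht : |t| * k < 1) :
    ∫ x, gaussianDegreeDensity F b x t = ((√(Real.pi / b) ^ Fintype.card ι : ℝ) : ℂ) := by
  have hlip : LipschitzWith (‖t‖₊ * k) fun x => t • F x := 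
    (lipschitzWith_smul t).comp hk
  have hbij : Function.Bijective fun x => x - t • F x := by
    refine bijective_id_sub_of_contractingWith ?_ hlip
    rw [← NNReal.coe_lt_coe]
    simpa using ht
  have hder : ∀ x ∈ Set.univ, HasFDerivWithinAt (fun x => x - t • F x)
      (ContinuousLinearMap.id ℝ (ι → ℝ) - t • fderiv ℝ F x) Set.univ x := fun x _ =>
    ((hasFDerivAt_id x).sub
      (((hF.differentiable one_ne_zero) x).hasFDerivAt.const_smul t)).hasFDerivWithinAt
  have := integral_image_eq_integral_abs_det_fderiv_smul (volume : Measure (ι → ℝ))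
    MeasurableSet.univ hder hbij.1.injOn fun y => Real.exp (-b * ∑ i, y i ^ 2)
  rw [Set.image_univ, hbij.2.range_eq, setIntegral_univ, setIntegral_univ,
    integral_exp_neg_mul_sum_sq] at this
  rw [this, ← integral_complex_ofReal]
  congr 1
  ext x
  rw [gaussianDegreeDensity_ofReal, ← det_one_sub_smul_jacobian,
    abs_of_pos (det_one_sub_smul_jacobian_pos hk ht x), smul_eq_mul, mul_comm]
  rfl

theorem integral_gaussianDegreeDensity {F : (ι → ℝ) → ι → ℝ} {C : ℝ} {k : NNReal} {b : ℝ}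
    (hb : 0 < b) (hF : ContDiff ℝ 1 F) (hC : ∀ x i, |F x i| ≤ C) (hk : LipschitzWith k F) (t : ℂ) :
    ∫ x, gaussianDegreeDensity F b x t = ((√(Real.pi / b) ^ Fintype.card ι : ℝ) : ℂ) := by
  have hd := differentiable_integral_gaussianDegreeDensity hb hF hC hk
  refine congrFun (AnalyticOnNhd.eq_of_frequently_eq (z₀ := 0)
    (fun z _ => hd.analyticAt z) (g := fun _ => ((√(Real.pi / b) ^ Fintype.card ι : ℝ) : ℂ))
    analyticOnNhd_const ?_) t
  have hev : ∀ᶠ t : ℝ in 𝓝[≠] 0, |t| * k < 1 := by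
    refine eventually_nhdsWithin_of_eventually_nhds ?_
    have : Continuous fun t : ℝ => |t| * (k : ℝ) := by fun_prop
    exact this.continuousAt.eventually_lt continuousAt_const (by simp)
  have hmap : Tendsto (fun t : ℝ => (t : ℂ)) (𝓝[≠] 0) (𝓝[≠] 0) := by
    refine tendsto_nhdsWithin_of_tendsto_nhds_of_eventually_within _ ?_ ?_
    · exact (Complex.continuous_ofReal.tendsto' 0 0 (by simp)).mono_left nhdsWithin_le_nhds
    · filter_upwards [self_mem_nhdsWithin] with t ht
      simpa using ht
  -- Small nonzero reals accumulate at `0`, which suffices for the identity theorem.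
  exact hmap.frequently
    (hev.mono fun t ht => integral_gaussianDegreeDensity_of_small b hF hk ht).frequently

/-- A bounded Lipschitz self-map of `ℝ^ι` of class `C^1` has a fixed point. -/
theorem exists_isFixedPt_of_contDiff_of_bounded {F : (ι → ℝ) → ι → ℝ} {C : ℝ} {k : NNReal}
    (hF : ContDiff ℝ 1 F) (hC : ∀ x, ‖F x‖ ≤ C) (hk : LipschitzWith k F) :
    ∃ x, Function.IsFixedPt F x := by
  by_contra! hne
  obtain ⟨δ, hδ, hle⟩ := exists_le_sum_sq_sub hF.continuous hC hne
  have hC' : ∀ x i, |F x i| ≤ C := fun x i => (norm_le_pi_norm (F x) i).trans (hC x)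
  set n := Fintype.card ι
  set M := ∫ x, ‖gaussianDegreeDensity F 1 x 1‖
  -- Splitting `b = (b - 1) + 1` leaves one unit of Gaussian for integrability, so `M` is
  -- independent of `b`.
  have hbound : ∀ b : ℝ, 1 ≤ b → √(Real.pi / b) ^ n ≤ Real.exp (-(b - 1) * δ) * M := by
    intro b hb
    have hb0 : 0 < b := by linarith
    have h := integral_gaussianDegreeDensity hb0 hF hC' hk 1
    calc √(Real.pi / b) ^ n = ‖∫ x, gaussianDegreeDensity F b x 1‖ := by
          rw [h, Complex.norm_real, Real.norm_of_nonneg (by positivity)]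
      _ ≤ ∫ x, ‖gaussianDegreeDensity F b x 1‖ := norm_integral_le_integral_norm _
      _ ≤ ∫ x, Real.exp (-(b - 1) * δ) * ‖gaussianDegreeDensity F 1 x 1‖ := by
          refine integral_mono (integrable_gaussianDegreeDensity hb0 hF hC' hk 1).norm
            ((integrable_gaussianDegreeDensity one_pos hF hC' hk 1).norm.const_mul _) fun x => ?_
          have e : ∀ c, ‖gaussianDegreeDensity F c x 1‖ =
              Real.exp (-c * ∑ i, (x i - F x i) ^ 2) * |(1 - jacobian F x).det| := fun c => by
            have := gaussianDegreeDensity_ofReal F c x 1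
            rw [Complex.ofReal_one] at this
            rw [this, Complex.norm_real, norm_mul, Real.norm_of_nonneg (Real.exp_pos _).le]
            simp
          simp only [e]
          rw [← mul_assoc, ← Real.exp_add]
          gcongr
          nlinarith [hle x]
      _ = _ := integral_const_mul _ _
  have hlim : Tendsto (fun b : ℝ => (√b ^ n * Real.exp (-δ * b)) * (Real.exp δ * M)) atTop
      (𝓝 (0 * (Real.exp δ * M))) := by
    refine Tendsto.mul_const _ ((tendsto_rpow_mul_exp_neg_mul_atTop_nhds_zero (n / 2) δ hδ).congr' ?_)
    filter_upwards [eventually_ge_atTop 0] with b hb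
    rw [Real.sqrt_eq_rpow, ← Real.rpow_mul_natCast hb]
    ring_nf
  rw [zero_mul] at hlim
  have hge : √Real.pi ^ n ≤ 0 := by
    refine ge_of_tendsto hlim ?_
    filter_upwards [eventually_ge_atTop 1] with b hb
    have hsb : 0 < √b := Real.sqrt_pos.2 (by linarith)
    have h := hbound b hb
    rw [Real.sqrt_div' _ (by linarith), div_pow, div_le_iff₀ (by positivity)] at h
    refine h.trans_eq ?_
    rw [show -(b - 1) * δ = -δ * b + δ by ring, Real.exp_add]
    ring
  have : 0 < √Real.pi ^ n := pow_pos (Real.sqrt_pos.2 Real.pi_pos) n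
  linarith

end

/-! ### The iteration map as a sigmoid of an affine map -/

theorem lipschitzWith_sigmoid : LipschitzWith 1 Real.sigmoid := by
  refine lipschitzWith_of_nnnorm_deriv_le differentiable_sigmoid fun x => ?_
  rw [Real.deriv_sigmoid, ← NNReal.coe_le_coe, coe_nnnorm, Real.norm_eq_abs]
  have h0 := Real.sigmoid_pos x
  have h1 := Real.sigmoid_lt_one x
  rw [abs_of_nonneg (by nlinarith)]
  push_cast
  nlinarith

namespace MPD

variable {K : ℕ} (z : Fin (2 * K) → ℝ) (J : Matrix (Fin (2 * K)) (Fin (2 * K)) ℝ)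
  (σ : Fin (2 * K) → ℝ)

/-- In the ratio of `fMinus` to `fPlus` the quadratic terms cancel: `VMinus² - VPlus² = 4 J_ii (z_i
- interference)`. -/
theorem iter_eq_sigmoid (p : Fin (2 * K) → ℝ) (i : Fin (2 * K)) :
    iter z J σ p i =
      Real.sigmoid (4 / (2 * σ i ^ 2) * J i i * (z i - interference J i p)) := by
  have h : fMinus z J σ i p = fPlus z J σ i p *
      Real.exp (-(4 / (2 * σ i ^ 2) * J i i * (z i - interference J i p))) := by
    rw [fMinus, fPlus, ← Real.exp_add, VMinus, VPlus]
    ring_nf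
  have hpos : 0 < fPlus z J σ i p := Real.exp_pos _
  rw [iter, h, Real.sigmoid_def, ← mul_one_add, div_mul_cancel_left₀ hpos.ne']

theorem contDiff_iter : ContDiff ℝ 1 (iter z J σ) := by
  refine contDiff_pi.2 fun i => ?_
  simp only [iter_eq_sigmoid, interference]
  exact (contDiff_sigmoid.of_le le_top).comp (by fun_prop)

theorem norm_iter_le_one (p : Fin (2 * K) → ℝ) : ‖iter z J σ p‖ ≤ 1 := by
  refine (pi_norm_le_iff_of_nonneg zero_le_one).2 fun i => ?_
  obtain ⟨h0, h1⟩ := iter_mem_cube z J σ p i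
  rwa [Real.norm_of_nonneg h0]

theorem exists_lipschitzWith_iter : ∃ k, LipschitzWith k (iter z J σ) := by
  have hcoord : ∀ i, ∃ k, LipschitzWith k fun p => iter z J σ p i := by
    intro i
    have hint : ∃ k, LipschitzWith k (interference J i) := by
      let L : (Fin (2 * K) → ℝ) →L[ℝ] ℝ :=
        ∑ j ∈ univ.erase i, (2 * J i j) • ContinuousLinearMap.proj j
      refine ⟨‖L‖₊, LipschitzWith.of_dist_le_mul fun p q => ?_⟩
      have : interference J i p - interference J i q = L p - L q := by
        simp only [interference, L, _root_.sum_apply, _root_.smul_apply,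
          ContinuousLinearMap.proj_apply, smul_eq_mul, ← sum_sub_distrib]
        exact sum_congr rfl fun j _ => by ring
      rw [dist_eq_norm, this, ← dist_eq_norm]
      exact L.lipschitz.dist_le_mul p q
    obtain ⟨k, hk⟩ := hint
    have h1 := lipschitzWith_sigmoid.comp ((lipschitzWith_smul (4 / (2 * σ i ^ 2) * J i i)).comp
      ((LipschitzWith.const (z i)).sub hk))
    exact ⟨_, by simpa only [iter_eq_sigmoid, Function.comp_def, smul_eq_mul] using h1⟩
  choose k hk using hcoord
  refine ⟨univ.sup k, LipschitzWith.of_dist_le_mul fun p q => ?_⟩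
  refine (dist_pi_le_iff (by positivity)).2 fun i => ((hk i).dist_le_mul p q).trans ?_
  gcongr
  exact le_sup (mem_univ i)

end MPD

theorem proposition1 (K : ℕ) (z : Fin (2 * K) → ℝ)
    (J : Matrix (Fin (2 * K)) (Fin (2 * K)) ℝ) (σ : Fin (2 * K) → ℝ) (hσ : ∀ i, 0 < σ i) :
    ∃ p : MPD.cube K, Function.IsFixedPt (MPD.iterOnCube z J σ) p := by
  obtain ⟨k, hk⟩ := MPD.exists_lipschitzWith_iter z J σ
  obtain ⟨p, hp⟩ := exists_isFixedPt_of_contDiff_of_bounded (MPD.contDiff_iter z J σ)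
    (MPD.norm_iter_le_one z J σ) hk
  have hp' : MPD.iter z J σ p = p := hp
  exact ⟨⟨p, hp' ▸ MPD.iter_mem_cube z J σ p⟩, Subtype.ext hp'⟩
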